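/- Let $N\ge 1$ be an integer, let $0<s<1$ with $N>2s$, and let $R>0$. Write $B_R=\{x\in\mathbb R^N:|x|<R\}$ and $$\Gamma_*(x)=\min\{|x|^{-(N-2s)},\,R^{-(N-2s)}\}\qquad(x\in\mathbb R^N),$$ with $\Gamma_*(0)=R^{-(N-2s)}$. For a measurable kernel $K:\mathbb R^N\setminus\{0\}\to(0,\infty)$, let $\mathcal L_K$ be the operator $\mathcal L_Ku(x)=\mathrm{P.V.}\!\int_{\mathbb R^N}(u(x)-u(y))K(x-y)\,dy$. We say that $\mathcal L_K\Gamma_*\ge 0$ in $\mathbb R^N\setminus\overline B_R$ in the weak sense (that is, $\Gamma_*$ is a weak supersolution of $\mathcal L_K$ there) if, for every $\phi\in C_0^\infty(\mathbb R^N\setminus\overline B_R)$ with $\phi\ge 0$, the function $(x,y)\mapsto(\Gamma_*(x)-\Gamma_*(y))(\phi(x)-\phi(y))K(x-y)$ is integrable on $\mathbb R^N\times\mathbb R^N$ and $$\int_{\mathbb R^N}\int_{\mathbb R^N}(\Gamma_*(x)-\Gamma_*(y))(\phi(x)-\phi(y))K(x-y)\,dx\,dy\ \ge\ 0 .$$ The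 fractional Laplacian $(-\Delta)^s$ is $\mathcal L_K$ with $K(z)=C_{N,s}|z|^{-(N+2s)}$, where $C_{N,s}=\dfrac{s\,4^s\,\Gamma(N/2+s)}{\pi^{N/2}\,\Gamma(1-s)}$ ($\Gamma$ without a star being Euler's Gamma function). Then: 1. $(-\Delta)^s\Gamma_*\ge 0$ in $\mathbb R^N\setminus\overline B_R$ in the weak sense. 2. Let $a\in C^\infty(\mathbb R^N)$ be radial with $0\le a\le 1$, $a(x)=0$ for $|x|\le R/2$ and $a(x)=1$ for $|x|\ge R$, and put $K_s(x)=(1+a(x))|x|^{-(N+2s)}$. Then $K_s$ is measurable, positive for $x\neq0$, and satisfies - (K1) $K_s(x)=K_s(-x)$ for all $x$; - (K2) there is $\mathcal C_1>0$ such that $K_s(x)\ge\mathcal C_1|x|^{-(N+2s)}$ for a.e. $x\in\mathbb R^N$; - (K3) $x\mapsto\min\{|x|^2,1\}\,K_s(x)$ belongs to $L^1(\mathbb R^N)$; - (K4) there is $\mathcal C_2>0$ such that $K_s(x)\le\mathcal C_2|x|^{-(N+2s)}$ for a.e. $x\in\mathbb R^N$; - (K5) $\mathcal L_{K_s}\Gamma_*\ge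 0$ in $\mathbb R^N\setminus\overline B_R$ in the weak sense, i.e. $\Gamma_*$ is a weak supersolution of $\mathcal L_{K_s}$ outside $\overline B_R$. -/

import Mathlib

open MeasureTheory Set
open scoped ContDiff

noncomputable section

namespace NonlocalKernel

/-- The space `ℝ^N` with its Euclidean norm. -/
abbrev Space (N : ℕ) : Type := EuclideanSpace ℝ (Fin N)

/-- The kernel `z ↦ |z|^{-(N+2s)}`. Its value at `z = 0` plays no role (the Lean convention
gives `0` there). -/
def standardKernel (N : ℕ) (s : ℝ) (z : Space N) : ℝ :=
  ‖z‖ ^ (-((N : ℝ) + 2 * s))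

/-- The normalization constant `C_{N,s} = s 4^s Γ(N/2 + s) / (π^{N/2} Γ(1 - s))`, for which the
kernel `C_{N,s} |z|^{-(N+2s)}` yields the operator with Fourier symbol `|ξ|^{2s}`. -/
def fracLapConst (N : ℕ) (s : ℝ) : ℝ :=
  s * (4 : ℝ) ^ s * Real.Gamma ((N : ℝ) / 2 + s) /
    (Real.pi ^ ((N : ℝ) / 2) * Real.Gamma (1 - s))

/-- The kernel of the fractional Laplacian `(-Δ)^s`. -/
def fracLapKernel (N : ℕ) (s : ℝ) (z : Space N) : ℝ :=
  fracLapConst N s * standardKernel N s z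

/-- The truncated fundamental solution `Γ_*(x) = min {|x|^{-(N-2s)}, R^{-(N-2s)}}`. At `x = 0`
the first entry is `+∞`, so that the minimum is `R^{-(N-2s)}`. -/
def truncatedFundamental (N : ℕ) (s R : ℝ) (x : Space N) : ℝ :=
  open Classical in
  if x = 0 then R ^ (-((N : ℝ) - 2 * s))
  else min (‖x‖ ^ (-((N : ℝ) - 2 * s))) (R ^ (-((N : ℝ) - 2 * s)))

/-- The integrand `(u(x) - u(y)) (v(x) - v(y)) K(x - y)` on `ℝ^N × ℝ^N`. -/
def energyDensity {N : ℕ} (K u v : Space N → ℝ) (p : Space N × Space N) : ℝ :=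
  (u p.1 - u p.2) * (v p.1 - v p.2) * K (p.1 - p.2)

/-- The bilinear form `[u, v]` with kernel `K`. -/
def energyForm {N : ℕ} (K u v : Space N → ℝ) : ℝ :=
  ∫ x, ∫ y, energyDensity K u v (x, y)

/-- `φ` is a nonnegative element of `C_0^∞(Ω)` (extended by zero to `ℝ^N`). -/
structure IsNonnegTestFunction {N : ℕ} (Ω : Set (Space N)) (φ : Space N → ℝ) : Prop where
  smooth : ContDiff ℝ ∞ φ
  compact : HasCompactSupport φ
  support : tsupport φ ⊆ Ω
  nonneg : ∀ x, 0 ≤ φ x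

/-- `L_K u ≥ 0` in `Ω` in the weak sense: for each nonnegative test function `φ` in `Ω` the form
`[u, φ]` is given by an absolutely convergent integral, and `[u, φ] ≥ 0`. -/
def IsWeakSupersolution {N : ℕ} (K u : Space N → ℝ) (Ω : Set (Space N)) : Prop :=
  ∀ φ : Space N → ℝ, IsNonnegTestFunction Ω φ →
    Integrable (energyDensity K u φ) (volume.prod volume) ∧ 0 ≤ energyForm K u φ

/-- The complement of the closed ball of radius `R` centred at the origin. -/
def exteriorDomain (N : ℕ) (R : ℝ) : Set (Space N) :=
  (Metric.closedBall 0 R)ᶜ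

/-- `K` is a positive measurable kernel (positive away from the origin, where kernels are
singular) that satisfies the hypotheses (K1)-(K5) with parameters `s` and `R`. -/
structure KernelHypotheses (N : ℕ) (s R : ℝ) (K : Space N → ℝ) : Prop where
  measurable : Measurable K
  pos : ∀ x, x ≠ 0 → 0 < K x
  k1 : ∀ x, K x = K (-x)
  k2 : ∃ C₁ : ℝ, 0 < C₁ ∧ ∀ᵐ x, C₁ * ‖x‖ ^ (-((N : ℝ) + 2 * s)) ≤ K x
  k3 : Integrable (fun x : Space N => min (‖x‖ ^ 2) 1 * K x)
  k4 : ∃ C₂ : ℝ, 0 < C₂ ∧ ∀ᵐ x, K x ≤ C₂ * ‖x‖ ^ (-((N : ℝ) + 2 * s))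
  k5 : IsWeakSupersolution K (truncatedFundamental N s R) (exteriorDomain N R)

/-- `a` is a smooth radial cut-off with values in `[0, 1]` that vanishes for `|x| ≤ R/2` and
equals `1` for `|x| ≥ R`. -/
structure IsRadialCutoff {N : ℕ} (R : ℝ) (a : Space N → ℝ) : Prop where
  smooth : ContDiff ℝ ∞ a
  radial : ∀ x y, ‖x‖ = ‖y‖ → a x = a y
  nonneg : ∀ x, 0 ≤ a x
  le_one : ∀ x, a x ≤ 1
  eq_zero : ∀ x, ‖x‖ ≤ R / 2 → a x = 0
  eq_one : ∀ x, R ≤ ‖x‖ → a x = 1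

/-- The perturbed kernel `K_s(x) = (1 + a(x)) |x|^{-(N+2s)}`. -/
def perturbedKernel (N : ℕ) (s : ℝ) (a : Space N → ℝ) (x : Space N) : ℝ :=
  (1 + a x) * standardKernel N s x

end NonlocalKernel

end

/-!
Write `Γ(x) = |x|^{-(N-2s)}` and `k(z) = |z|^{-(N+2s)}`. Both kernels have the form
`K(z) = (A - X(|z|²)) k(z)` with `0 ≤ X ≤ A` continuous and `X(|z|²) = 0` for `|z| ≥ R`: take
`X = 0` for the fractional Laplacian, and `A = 2`, `X = 1 - a` for the perturbed kernel. For such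
kernels `isWeakSupersolution_truncatedFundamental` rests on three facts about a point `|x| > R`.

* `Γ` is the Kelvin transform of a constant. Inversion in the sphere of radius `|x|` changes the
  sign of `(Γ(x) - Γ(y)) k(x - y) dy`, so the integral of this density over any set of `y`
  invariant under that inversion is zero (`setIntegral_shellCompl_eq_zero`). The sets used leave
  out a shell `1/ρ < |y| / |x| < ρ`; this condition is symmetric in `x` and `y`.
* `Γ` is subharmonic away from the origin. As `X` is radial and supported in `|z| ≤ R < |x|`, its
  contribution has the right sign (`integral_radial_mul_norm_rpow_sub_nonneg`). The proof
  differentiates along the dilations `x + t z` and integrates by parts against a radial potential.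
* `Γ_* = Γ - g` with `g ≥ 0` supported in the closed ball, where `x` does not lie. So `g` adds
  `∫ g(y) K(x - y) dy ≥ 0`.

To avoid principal values, `K(x - y)` is replaced by the symmetric kernels `approxKernel`, for
which the integrals in `x` and `y` converge absolutely after the increment of `φ` is split. Since
`Γ_*` is bounded and Lipschitz, dominated convergence leads back to `K`.
-/

namespace NonlocalKernel

theorem dimension_pos {N : ℕ} {s : ℝ} (hs0 : 0 < s) (hN : 2 * s < N) : 0 < N := by
  have h : (0 : ℝ) < N := by linarith
  exact_mod_cast h

theorem finrank_space (N : ℕ) : Module.finrank ℝ (Space N) = N := finrank_euclideanSpace_fin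

theorem nontrivial_space {N : ℕ} (hN0 : 0 < N) : Nontrivial (Space N) :=
  Module.nontrivial_of_finrank_pos (R := ℝ) (by rwa [finrank_space])

/-! ### Elementary bounds and integrability -/

theorem truncatedFundamental_eq_rpow_max {N : ℕ} {s R : ℝ} (hN : 2 * s < N) (hR : 0 < R)
    (x : Space N) : truncatedFundamental N s R x = max ‖x‖ R ^ (-((N : ℝ) - 2 * s)) := by
  have hα : -((N : ℝ) - 2 * s) ≤ 0 := by linarith
  unfold truncatedFundamental
  split_ifs with hx
  · simp [hx, hR.le]
  · have hx' : 0 < ‖x‖ := norm_pos_iff.2 hx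
    rcases le_total ‖x‖ R with h | h
    · rw [max_eq_right h, min_eq_right (Real.rpow_le_rpow_of_nonpos hx' h hα)]
    · rw [max_eq_left h, min_eq_left (Real.rpow_le_rpow_of_nonpos hR h hα)]

theorem continuous_truncatedFundamental {N : ℕ} {s R : ℝ} (hN : 2 * s < N) (hR : 0 < R) :
    Continuous (truncatedFundamental N s R) := by
  rw [funext (truncatedFundamental_eq_rpow_max hN hR)]
  exact (continuous_norm.max continuous_const).rpow_const
    fun x => Or.inl (lt_max_of_lt_right hR).ne'

theorem truncatedFundamental_nonneg {N : ℕ} {s R : ℝ} (hN : 2 * s < N) (hR : 0 < R)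
    (x : Space N) : 0 ≤ truncatedFundamental N s R x := by
  rw [truncatedFundamental_eq_rpow_max hN hR]; positivity

theorem truncatedFundamental_le {N : ℕ} {s R : ℝ} (hN : 2 * s < N) (hR : 0 < R)
    (x : Space N) : truncatedFundamental N s R x ≤ R ^ (-((N : ℝ) - 2 * s)) := by
  rw [truncatedFundamental_eq_rpow_max hN hR]
  exact Real.rpow_le_rpow_of_nonpos hR (le_max_right _ _) (by linarith)

theorem abs_truncatedFundamental_sub_le {N : ℕ} {s R : ℝ} (hN : 2 * s < N) (hR : 0 < R)
    (x y : Space N) : |truncatedFundamental N s R x - truncatedFundamental N s R y| ≤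
      R ^ (-((N : ℝ) - 2 * s)) := by
  have h1 := truncatedFundamental_le hN hR x
  have h2 := truncatedFundamental_le hN hR y
  have h3 := truncatedFundamental_nonneg hN hR x
  have h4 := truncatedFundamental_nonneg hN hR y
  rw [abs_le]; constructor <;> linarith

/-- Negative powers are Lipschitz away from the origin, hence so is `Γ_*`. -/
theorem exists_lipschitz_truncatedFundamental {N : ℕ} {s R : ℝ} (hN : 2 * s < N) (hR : 0 < R) :
    ∃ C : ℝ, 0 ≤ C ∧ ∀ x y : Space N,
      |truncatedFundamental N s R x - truncatedFundamental N s R y| ≤ C * ‖x - y‖ := by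
  set α : ℝ := (N : ℝ) - 2 * s with hα
  have hα0 : 0 < α := by linarith
  refine ⟨α * R ^ (-α - 1), by positivity, fun x y => ?_⟩
  rw [truncatedFundamental_eq_rpow_max hN hR, truncatedFundamental_eq_rpow_max hN hR]
  have key := (convex_Ici R).norm_image_sub_le_of_norm_hasDerivWithin_le
    (f := fun v : ℝ => v ^ (-α)) (f' := fun v => -α * v ^ (-α - 1)) (C := α * R ^ (-α - 1))
    (fun v hv => (Real.hasDerivAt_rpow_const
      (Or.inl (hR.trans_le (mem_Ici.1 hv)).ne')).hasDerivWithinAt)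
    (fun v hv => by
      have hv0 : 0 < v := hR.trans_le hv
      rw [norm_mul, norm_neg, Real.norm_of_nonneg hα0.le,
        Real.norm_of_nonneg (Real.rpow_nonneg hv0.le _)]
      exact mul_le_mul_of_nonneg_left
        (Real.rpow_le_rpow_of_nonpos hR hv (by linarith)) hα0.le)
    (le_max_right ‖y‖ R) (le_max_right ‖x‖ R)
  refine key.trans (mul_le_mul_of_nonneg_left ?_ (by positivity))
  calc ‖max ‖x‖ R - max ‖y‖ R‖ ≤ |‖x‖ - ‖y‖| := abs_max_sub_max_le_abs _ _ _
    _ ≤ ‖x - y‖ := abs_norm_sub_norm_le x y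

theorem standardKernel_nonneg (N : ℕ) (s : ℝ) (z : Space N) : 0 ≤ standardKernel N s z := by
  unfold standardKernel; positivity

theorem standardKernel_neg (N : ℕ) (s : ℝ) (z : Space N) :
    standardKernel N s (-z) = standardKernel N s z := by
  simp [standardKernel]

theorem measurable_standardKernel (N : ℕ) (s : ℝ) : Measurable (standardKernel N s) := by
  unfold standardKernel; fun_prop

/-- The Lévy integrability condition for `|z|^{-(N+2s)}`, checked in polar coordinates. -/
theorem integrable_min_mul_standardKernel {N : ℕ} {s : ℝ} (hs0 : 0 < s) (hs1 : s < 1)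
    (hN0 : 0 < N) :
    Integrable fun z : Space N => min (‖z‖ ^ 2) 1 * standardKernel N s z := by
  have := nontrivial_space hN0
  have hpow : ∀ y : ℝ, 0 < y → y ^ (N - 1) * y ^ (-((N : ℝ) + 2 * s)) = y ^ (-1 - 2 * s) := by
    intro y hy
    rw [← Real.rpow_natCast, ← Real.rpow_add hy, Nat.cast_sub hN0]
    congr 1; push_cast; ring
  refine (integrable_fun_norm_addHaar (volume : Measure (Space N))
    (f := fun y : ℝ => min (y ^ 2) 1 * y ^ (-((N : ℝ) + 2 * s)))).2 ?_
  rw [finrank_space, ← Ioc_union_Ioi_eq_Ioi zero_le_one]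
  refine IntegrableOn.union ?_ ?_
  · have h : IntegrableOn (fun y : ℝ => y ^ (1 - 2 * s)) (Ioc 0 1) :=
      (intervalIntegrable_iff_integrableOn_Ioc_of_le zero_le_one).1
        (intervalIntegral.intervalIntegrable_rpow' (by linarith))
    refine h.congr_fun (fun y hy => ?_) measurableSet_Ioc
    have h1 : y ^ 2 ≤ 1 := pow_le_one₀ hy.1.le hy.2
    simp only [smul_eq_mul]
    rw [min_eq_left h1, mul_left_comm, hpow y hy.1, ← Real.rpow_natCast, ← Real.rpow_add hy.1]
    congr 1; push_cast; ring
  · have h : IntegrableOn (fun y : ℝ => y ^ (-1 - 2 * s)) (Ioi 1) :=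
      integrableOn_Ioi_rpow_of_lt (by linarith) one_pos
    refine h.congr_fun (fun y hy => ?_) measurableSet_Ioi
    have hy' : (1 : ℝ) < y := hy
    have h1 : 1 ≤ y ^ 2 := one_le_pow₀ hy'.le
    simp only [smul_eq_mul]
    rw [min_eq_right h1, one_mul, hpow y (one_pos.trans hy')]

theorem integrableOn_ball_norm_rpow {N : ℕ} {s : ℝ} (hs0 : 0 < s) (hN0 : 0 < N) (r : ℝ) :
    IntegrableOn (fun y : Space N => ‖y‖ ^ (-((N : ℝ) - 2 * s))) (Metric.ball 0 r) := by
  have := nontrivial_space hN0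
  refine (integrableOn_fun_norm_addHaar (volume : Measure (Space N))
    (f := fun y : ℝ => y ^ (-((N : ℝ) - 2 * s)))).2 ?_
  rw [finrank_space]
  rcases le_total r 0 with hr | hr
  · simp [Ioo_eq_empty_of_le hr]
  have h : IntegrableOn (fun y : ℝ => y ^ (2 * s - 1)) (Ioo 0 r) :=
    ((intervalIntegrable_iff_integrableOn_Ioc_of_le hr).1
      (intervalIntegral.intervalIntegrable_rpow' (by linarith))).mono_set Ioo_subset_Ioc_self
  refine h.congr_fun (fun y hy => ?_) measurableSet_Ioo
  simp only [smul_eq_mul]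
  rw [← Real.rpow_natCast, ← Real.rpow_add hy.1, Nat.cast_sub hN0]
  congr 1; push_cast; ring

theorem integrable_prod_mul_comp_sub {N : ℕ} {f g : Space N → ℝ} (hf : Integrable f)
    (hg : Integrable g) :
    Integrable (fun p : Space N × Space N => f p.1 * g (p.2 - p.1)) (volume.prod volume) :=
  (measurePreserving_prod_sub (volume : Measure (Space N)) volume).integrable_comp_of_integrable
    (hf.mul_prod hg)

/-- The energy of a bounded Lipschitz function against a compactly supported smooth one converges
absolutely: near the diagonal the two increments contribute `|x - y|²`, and far from it one of
the points lies in the support of `φ`. -/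
theorem integrable_energyDensity_standardKernel {N : ℕ} {s R : ℝ} (hs0 : 0 < s) (hs1 : s < 1)
    (hN : 2 * s < N) (hR : 0 < R) {φ : Space N → ℝ} (hφ : ContDiff ℝ ∞ φ)
    (hc : HasCompactSupport φ) :
    Integrable (energyDensity (standardKernel N s) (truncatedFundamental N s R) φ)
      (volume.prod volume) := by
  have hN0 : 0 < N := dimension_pos hs0 hN
  obtain ⟨C, hC0, hC⟩ := exists_lipschitz_truncatedFundamental hN hR
  obtain ⟨L, hL⟩ := hφ.lipschitzWith_of_hasCompactSupport hc (by simp)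
  obtain ⟨M, hM⟩ := hc.exists_bound_of_continuous hφ.continuous
  have hM0 : 0 ≤ M := (norm_nonneg _).trans (hM 0)
  set B : ℝ := R ^ (-((N : ℝ) - 2 * s))
  have hB0 : 0 ≤ B := by positivity
  set S := tsupport φ
  have hS : IsCompact S := hc
  have hind : Integrable (S.indicator fun _ => (1 : ℝ)) :=
    (integrable_indicator_iff hS.measurableSet).2 (integrableOn_const hS.measure_lt_top.ne)
  have hκ := integrable_min_mul_standardKernel hs0 hs1 hN0
  have h1 := integrable_prod_mul_comp_sub hind hκ
  have h2 := h1.swap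
  refine ((h1.add h2).const_mul (C * L + B * (2 * M))).mono' ?_ (ae_of_all _ fun p => ?_)
  · have hu := (continuous_truncatedFundamental hN hR).measurable
    have hk := measurable_standardKernel N s
    have hφm := hφ.continuous.measurable
    unfold energyDensity
    fun_prop
  obtain ⟨x, y⟩ := p
  simp only [energyDensity, Pi.add_apply, Function.comp_apply, Prod.swap_prod_mk, norm_mul]
  have hk0 := standardKernel_nonneg N s (x - y)
  rw [Real.norm_of_nonneg hk0, Real.norm_eq_abs, Real.norm_eq_abs]
  have hsym : standardKernel N s (y - x) = standardKernel N s (x - y) := by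
    rw [← standardKernel_neg, neg_sub]
  rw [hsym, norm_sub_rev y x, ← add_mul]
  by_cases hxy : x ∈ S ∨ y ∈ S
  · have hone : 1 ≤ S.indicator (fun _ => (1 : ℝ)) x + S.indicator (fun _ => (1 : ℝ)) y := by
      by_cases hx : x ∈ S <;> by_cases hy : y ∈ S <;> simp_all
    have hu1 := hC x y
    have hu2 := abs_truncatedFundamental_sub_le hN hR x y
    have hφ1 : |φ x - φ y| ≤ L * ‖x - y‖ := by
      simpa [dist_eq_norm] using hL.dist_le_mul x y
    have hφ2 : |φ x - φ y| ≤ 2 * M := by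
      have := norm_sub_le (φ x) (φ y)
      have a1 := hM x
      have a2 := hM y
      rw [Real.norm_eq_abs] at this
      linarith
    have hprod : |truncatedFundamental N s R x - truncatedFundamental N s R y| * |φ x - φ y| ≤
        (C * L + B * (2 * M)) * min (‖x - y‖ ^ 2) 1 := by
      have hL0 : (0 : ℝ) ≤ L := L.2
      rcases min_choice (‖x - y‖ ^ 2) (1 : ℝ) with h | h <;> rw [h]
      · calc _ ≤ (C * ‖x - y‖) * (L * ‖x - y‖) :=
              mul_le_mul hu1 hφ1 (abs_nonneg _) (by positivity)
          _ = C * L * ‖x - y‖ ^ 2 := by ring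
          _ ≤ _ := mul_le_mul_of_nonneg_right (le_add_of_nonneg_right (by positivity))
              (by positivity)
      · calc _ ≤ B * (2 * M) := mul_le_mul hu2 hφ2 (abs_nonneg _) hB0
          _ ≤ _ := by rw [mul_one]; exact le_add_of_nonneg_left (by positivity)
    have hm : 0 ≤ min (‖x - y‖ ^ 2) 1 * standardKernel N s (x - y) :=
      mul_nonneg (le_min (by positivity) zero_le_one) hk0
    calc _ ≤ (C * L + B * (2 * M)) * min (‖x - y‖ ^ 2) 1 * standardKernel N s (x - y) :=
          mul_le_mul_of_nonneg_right hprod hk0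
      _ = (C * L + B * (2 * M)) * (1 * (min (‖x - y‖ ^ 2) 1 * standardKernel N s (x - y))) := by
          ring
      _ ≤ _ := mul_le_mul_of_nonneg_left (mul_le_mul_of_nonneg_right hone hm) (by positivity)
  · push Not at hxy
    have hx0 : φ x = 0 := image_eq_zero_of_notMem_tsupport hxy.1
    have hy0 : φ y = 0 := image_eq_zero_of_notMem_tsupport hxy.2
    simp [hx0, hy0, hxy.1, hxy.2]

/-! ### Vanishing by inversion -/

/-- The pairs `(x, y)` for which `|x|` and `|y|` differ by a factor of at least `ρ`: the complement
of a neighbourhood of the diagonal, made of shells. -/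
def shellCompl {N : ℕ} (ρ : ℝ) : Set (Space N × Space N) :=
  {p | ρ * ‖p.1‖ ≤ ‖p.2‖ ∨ ρ * ‖p.2‖ ≤ ‖p.1‖}

theorem measurableSet_shellCompl {N : ℕ} (ρ : ℝ) :
    MeasurableSet (shellCompl ρ : Set (Space N × Space N)) :=
  ((isClosed_le (continuous_fst.norm.const_mul ρ) continuous_snd.norm).union
    (isClosed_le (continuous_snd.norm.const_mul ρ) continuous_fst.norm)).measurableSet

theorem abs_det_fderiv_inversion {N : ℕ} (r : ℝ) (y : Space N) :
    |((r / dist y 0) ^ 2 • ((ℝ ∙ (y - 0))ᗮ.reflection : Space N →L[ℝ] Space N)).det| =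
      (r / ‖y‖) ^ (2 * N) := by
  set V := (ℝ ∙ (y - 0))ᗮ
  have hdet : LinearMap.det (V.reflection.toLinearEquiv : Space N →ₗ[ℝ] Space N) =
      (-1) ^ Module.finrank ℝ Vᗮ := Submodule.det_reflection V
  have h : |LinearMap.det (V.reflection.toLinearEquiv : Space N →ₗ[ℝ] Space N)| = 1 := by
    rw [hdet]; simp
  have h' : ((r / dist y 0) ^ 2 • (V.reflection : Space N →L[ℝ] Space N)).det =
      ((r / dist y 0) ^ 2) ^ Module.finrank ℝ (Space N) *
        LinearMap.det (V.reflection.toLinearEquiv : Space N →ₗ[ℝ] Space N) :=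
    LinearMap.det_smul _ _
  rw [h', abs_mul, h, mul_one, finrank_euclideanSpace_fin, dist_zero_right, ← pow_mul,
    abs_of_nonneg]
  rw [pow_mul]; positivity

/-- `Γ(x) = |x|^{-(N-2s)}` is the Kelvin transform of a constant: inversion in the sphere through
`x` maps the integrand to its negative. -/
theorem setIntegral_shellCompl_eq_zero {N : ℕ} {s : ℝ} {x : Space N} (hx : x ≠ 0) {ρ : ℝ} :
    ∫ y in {y | y ≠ 0 ∧ (x, y) ∈ shellCompl ρ},
      (‖x‖ ^ (-((N : ℝ) - 2 * s)) - ‖y‖ ^ (-((N : ℝ) - 2 * s))) * standardKernel N s (x - y) =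
        0 := by
  set T := {y | y ≠ 0 ∧ (x, y) ∈ shellCompl ρ} with hT
  set f : Space N → ℝ := fun y =>
    (‖x‖ ^ (-((N : ℝ) - 2 * s)) - ‖y‖ ^ (-((N : ℝ) - 2 * s))) * standardKernel N s (x - y) with hf
  set r := ‖x‖ with hr
  have hr0 : 0 < r := norm_pos_iff.2 hx
  set I := EuclideanGeometry.inversion (0 : Space N) r with hI
  have hInorm : ∀ y, ‖I y‖ = r ^ 2 / ‖y‖ := fun y => by
    simpa using EuclideanGeometry.dist_inversion_center (0 : Space N) y r
  have hinv : Function.Involutive I := EuclideanGeometry.inversion_involutive _ hr0.ne'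
  have hIx : I x = x := by
    have := EuclideanGeometry.inversion_dist_center (0 : Space N) x
    simpa [hI, hr] using this
  have hmaps : MapsTo I T T := by
    rintro y ⟨hy0, hy⟩
    have hy' : 0 < ‖y‖ := norm_pos_iff.2 hy0
    refine ⟨norm_pos_iff.1 (by rw [hInorm]; positivity), ?_⟩
    simp only [shellCompl, mem_ofPred_eq, hInorm, ← hr] at hy ⊢
    rw [le_div_iff₀ hy', mul_div_assoc', div_le_iff₀ hy']
    rcases hy with h | h
    · right; nlinarith
    · left; nlinarith
  have himage : I '' T = T := by
    refine Subset.antisymm hmaps.image_subset fun y hy => ⟨I y, hmaps hy, hinv y⟩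
  have hTm : MeasurableSet T :=
    (measurableSet_singleton 0).compl.inter (measurableSet_shellCompl ρ |>.preimage (by fun_prop))
  have key := integral_image_eq_integral_abs_det_fderiv_smul volume hTm
    (fun y hy => (EuclideanGeometry.hasFDerivAt_inversion (R := r) (c := (0 : Space N))
      hy.1).hasFDerivWithinAt) hinv.injective.injOn f
  rw [← hI, himage] at key
  have hneg : ∫ y in T, |((r / dist y 0) ^ 2 •
      ((ℝ ∙ (y - 0))ᗮ.reflection : Space N →L[ℝ] Space N)).det| • f (I y) = ∫ y in T, -f y := by
    refine setIntegral_congr_fun hTm fun y hy => ?_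
    have hy' : 0 < ‖y‖ := norm_pos_iff.2 hy.1
    have hdist : ‖x - I y‖ = r / ‖y‖ * ‖x - y‖ := by
      have := EuclideanGeometry.dist_inversion_inversion hx hy.1 r
      rw [← hI, hIx, dist_zero_right, dist_zero_right, dist_eq_norm, dist_eq_norm, ← hr] at this
      rw [this]; field_simp
    simp only [abs_det_fderiv_inversion, hf, standardKernel, smul_eq_mul, hdist, hInorm]
    rw [Real.mul_rpow (by positivity) (by positivity), ← Real.rpow_natCast]
    set q := r / ‖y‖ with hq
    have hq0 : 0 < q := by positivity
    have h1 : r ^ 2 / ‖y‖ = r * q := by rw [hq]; ring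
    have h2 : ‖y‖ = r / q := by rw [hq]; field_simp
    rw [h1, h2, Real.mul_rpow hr0.le hq0.le, Real.div_rpow hr0.le hq0.le]
    have h3 : q ^ ((2 * N : ℕ) : ℝ) * q ^ (-((N : ℝ) + 2 * s)) = q ^ ((N : ℝ) - 2 * s) := by
      rw [← Real.rpow_add hq0]; congr 1; push_cast; ring
    have h4 : q ^ ((N : ℝ) - 2 * s) * q ^ (-((N : ℝ) - 2 * s)) = 1 := by
      rw [← Real.rpow_add hq0]; simp
    have h5 : q ^ (-((N : ℝ) - 2 * s)) ≠ 0 := by positivity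
    have h6 : (q ^ (-((N : ℝ) - 2 * s)))⁻¹ = q ^ ((N : ℝ) - 2 * s) := by
      rw [eq_comm, ← mul_eq_one_iff_eq_inv₀ h5, h4]
    rw [div_eq_mul_inv, h6]
    set a := q ^ ((2 * N : ℕ) : ℝ)
    set b := q ^ (-((N : ℝ) + 2 * s))
    set c := q ^ ((N : ℝ) - 2 * s)
    set d := q ^ (-((N : ℝ) - 2 * s))
    linear_combination ‖x - y‖ ^ (-((N : ℝ) + 2 * s)) * r ^ (-((N : ℝ) - 2 * s)) *
      ((1 - d) * h3 - h4)
  rw [hneg, integral_neg] at key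
  linarith

/-! ### A weighted mean value inequality -/

/-- `P(z) = ½ ∫_{|z|²}^{R²} w`, the radial function that vanishes for `|z| = R` and satisfies
`∇P(z) = -w(|z|²) z`. -/
noncomputable def radialPotential {N : ℕ} (w : ℝ → ℝ) (R : ℝ) (z : Space N) : ℝ :=
  2⁻¹ * ∫ v in (‖z‖ ^ 2)..(R ^ 2), w v

theorem hasFDerivAt_radialPotential {N : ℕ} {w : ℝ → ℝ} (hw : Continuous w) (R : ℝ)
    (z : Space N) :
    HasFDerivAt (radialPotential w R) (-(w (‖z‖ ^ 2)) • innerSL ℝ z) z := by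
  have h1 : HasDerivAt (fun a => ∫ v in a..(R ^ 2), w v) (-w (‖z‖ ^ 2)) (‖z‖ ^ 2) :=
    intervalIntegral.integral_hasDerivAt_left (hw.intervalIntegrable _ _)
      (hw.stronglyMeasurableAtFilter _ _) hw.continuousAt
  have h2 := (h1.comp_hasFDerivAt z (hasStrictFDerivAt_norm_sq z).hasFDerivAt).const_mul (2⁻¹ : ℝ)
  refine h2.congr_fderiv ?_
  ext e
  simp
  ring

theorem radialPotential_eq_zero {N : ℕ} {w : ℝ → ℝ} {R : ℝ} (hR : 0 ≤ R)
    (h0 : ∀ v, R ^ 2 ≤ v → w v = 0) {z : Space N} (hz : R ≤ ‖z‖) :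
    radialPotential w R z = 0 := by
  have : ∫ v in (‖z‖ ^ 2)..(R ^ 2), w v = ∫ v in (‖z‖ ^ 2)..(R ^ 2), (0 : ℝ) := by
    refine intervalIntegral.integral_congr fun v hv => h0 v ?_
    rw [uIcc_of_ge (by gcongr)] at hv
    exact hv.1
  simp [radialPotential, this]

theorem radialPotential_nonneg {N : ℕ} {w : ℝ → ℝ} {R : ℝ} (hR : 0 ≤ R)
    (hw0 : ∀ v, 0 ≤ w v) (h0 : ∀ v, R ^ 2 ≤ v → w v = 0) (z : Space N) :
    0 ≤ radialPotential w R z := by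
  rcases le_total R ‖z‖ with h | h
  · rw [radialPotential_eq_zero hR h0 h]
  · exact mul_nonneg (by norm_num)
      (intervalIntegral.integral_nonneg (by gcongr) fun v _ => hw0 v)

theorem tsupport_radialPotential_subset {N : ℕ} {w : ℝ → ℝ} {R : ℝ} (hR : 0 ≤ R)
    (h0 : ∀ v, R ^ 2 ≤ v → w v = 0) :
    tsupport (radialPotential w R : Space N → ℝ) ⊆ Metric.closedBall 0 R := by
  refine closure_minimal (fun z hz => ?_) Metric.isClosed_closedBall
  rw [mem_closedBall_zero_iff]
  by_contra! h
  exact hz (radialPotential_eq_zero hR h0 h.le)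

theorem hasDerivAt_norm_rpow_line {N : ℕ} (a : ℝ) (x z : Space N) (t : ℝ) (h : x + t • z ≠ 0) :
    HasDerivAt (fun τ : ℝ => ‖x + τ • z‖ ^ (-a))
      (-a * (inner ℝ (x + t • z) z * ‖x + t • z‖ ^ (-(a + 2)))) t := by
  have h0 : 0 < ‖x + t • z‖ := norm_pos_iff.2 h
  have h1 : HasDerivAt (fun τ : ℝ => x + τ • z) z t := by
    simpa using ((hasDerivAt_id t).smul_const z).const_add x
  have h2 := h1.norm_sq.rpow_const (p := -a / 2) (Or.inl (by positivity))
  have e : (fun τ : ℝ => ‖x + τ • z‖ ^ (-a)) = fun τ => (‖x + τ • z‖ ^ 2) ^ (-a / 2) := by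
    ext τ
    rw [← Real.rpow_natCast, ← Real.rpow_mul (norm_nonneg _)]
    congr 1; push_cast; ring
  rw [e]
  refine h2.congr_deriv ?_
  rw [← Real.rpow_natCast, ← Real.rpow_mul (norm_nonneg _)]
  rw [show ((2 : ℕ) : ℝ) * (-a / 2 - 1) = -(a + 2) by push_cast; ring]
  ring

theorem add_smul_ne_zero_of_norm_lt {N : ℕ} {R : ℝ} {x z : Space N} {t : ℝ} (hx : R < ‖x‖)
    (ht : t ∈ Icc (0 : ℝ) 1) (hz : z ∈ Metric.closedBall 0 R) : x + t • z ≠ 0 := by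
  intro h
  rw [mem_closedBall_zero_iff] at hz
  have : ‖x‖ = t * ‖z‖ := by
    rw [eq_neg_of_add_eq_zero_left h, norm_neg, norm_smul, Real.norm_of_nonneg ht.1]
  nlinarith [norm_nonneg z, ht.2]

theorem integrable_of_continuousOn_closedBall {N : ℕ} {R : ℝ} {f : Space N → ℝ}
    (hf : ContinuousOn f (Metric.closedBall 0 R)) (h0 : ∀ z, R ≤ ‖z‖ → f z = 0) :
    Integrable f := by
  rw [← integrableOn_iff_integrable_of_support_subset (s := Metric.closedBall 0 R)]
  · exact hf.integrableOn_compact (isCompact_closedBall _ _)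
  · intro z hz
    rw [mem_closedBall_zero_iff]
    by_contra! h
    exact hz (h0 z h.le)

/-- Divergence theorem for the field `P(z) |y|^{-β} y`, `y = x + t z`, where `P` is the radial
potential of `w`: away from `y = 0` the field `|y|^{-β} y` has divergence `(N - β) |y|^{-β}`. -/
theorem integral_inner_mul_norm_rpow_eq {N : ℕ} {w : ℝ → ℝ} (hw : Continuous w) {R : ℝ}
    (hR : 0 ≤ R) (h0 : ∀ v, R ^ 2 ≤ v → w v = 0) {x : Space N} (hx : R < ‖x‖) (β : ℝ) {t : ℝ}
    (ht : t ∈ Icc (0 : ℝ) 1) :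
    ∫ z, w (‖z‖ ^ 2) * (inner ℝ (x + t • z) z * ‖x + t • z‖ ^ (-β)) =
      (t * (N - β)) * ∫ z, radialPotential w R z * ‖x + t • z‖ ^ (-β) := by
  have hne : ∀ z ∈ Metric.closedBall (0 : Space N) R, x + t • z ≠ 0 := fun z hz =>
    add_smul_ne_zero_of_norm_lt hx ht hz
  have hsq : ∀ z : Space N, R ≤ ‖z‖ → R ^ 2 ≤ ‖z‖ ^ 2 := fun z hz => by gcongr
  have hPc : Continuous (radialPotential w R : Space N → ℝ) :=
    continuous_iff_continuousAt.2 fun z => (hasFDerivAt_radialPotential hw R z).continuousAt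
  have hc : ∀ γ : ℝ, ContinuousOn (fun z : Space N => ‖x + t • z‖ ^ γ) (Metric.closedBall 0 R) :=
    fun γ => ContinuousOn.rpow_const (by fun_prop)
      fun z hz => Or.inl (norm_ne_zero_iff.2 (hne z hz))
  have hcoord : ∀ i : Fin N, Continuous fun z : Space N => (x + t • z) i := fun i => by fun_prop
  -- integration by parts in each coordinate direction
  have key : ∀ i : Fin N,
      ∫ z, radialPotential w R z * (t * (‖x + t • z‖ ^ (-β) -
        β * ((x + t • z) i ^ 2 * ‖x + t • z‖ ^ (-(β + 2))))) =
      ∫ z, w (‖z‖ ^ 2) * (((x + t • z) i * z i) * ‖x + t • z‖ ^ (-β)) := by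
    intro i
    have ibp := integral_bilinear_hasLineDerivAt_right_eq_neg_left_of_integrable
      (μ := (volume : Measure (Space N))) (v := EuclideanSpace.single i (1 : ℝ))
      (f := radialPotential w R) (f' := fun z => -(w (‖z‖ ^ 2)) * z i)
      (g := fun z => ‖x + t • z‖ ^ (-β) * (x + t • z) i)
      (g' := fun z => t * (‖x + t • z‖ ^ (-β) -
        β * ((x + t • z) i ^ 2 * ‖x + t • z‖ ^ (-(β + 2)))))
      (B := ContinuousLinearMap.mul ℝ ℝ) ?_ ?_ ?_ ?_ ?_
    · simp only [ContinuousLinearMap.mul_apply'] at ibp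
      rw [ibp, ← integral_neg]
      congr 1; ext z; ring
    · refine integrable_of_continuousOn_closedBall (R := R) ?_ fun z hz => ?_
      · simp only [ContinuousLinearMap.mul_apply']
        have := hc (-β)
        have := hcoord i
        fun_prop
      · simp [h0 _ (hsq z hz)]
    · refine integrable_of_continuousOn_closedBall (R := R) ?_ fun z hz => ?_
      · simp only [ContinuousLinearMap.mul_apply']
        have := hc (-β)
        have := hc (-(β + 2))
        have := hcoord i
        fun_prop
      · simp [radialPotential_eq_zero hR h0 hz]
    · refine integrable_of_continuousOn_closedBall (R := R) ?_ fun z hz => ?_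
      · simp only [ContinuousLinearMap.mul_apply']
        have := hc (-β)
        have := hcoord i
        fun_prop
      · simp [radialPotential_eq_zero hR h0 hz]
    · intro z _
      have := (hasFDerivAt_radialPotential hw R z).hasLineDerivAt (EuclideanSpace.single i (1 : ℝ))
      simpa [EuclideanSpace.inner_single_right] using this
    · intro z hz
      have hz' := hne z (tsupport_radialPotential_subset hR h0 hz)
      have h1 := hasDerivAt_norm_rpow_line β (x + t • z) (t • EuclideanSpace.single i (1 : ℝ)) 0
        (by simpa using hz')
      have h2 : HasDerivAt (fun τ : ℝ => (x + t • z) i + τ * t) t 0 := by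
        simpa using ((hasDerivAt_id (0 : ℝ)).mul_const t).const_add ((x + t • z) i)
      have h3 := h1.mul h2
      unfold HasLineDerivAt
      have e : (fun τ : ℝ => ‖x + t • (z + τ • EuclideanSpace.single i (1 : ℝ))‖ ^ (-β) *
          (x + t • (z + τ • EuclideanSpace.single i (1 : ℝ))) i) =
          (fun τ : ℝ => ‖x + t • z + τ • (t • EuclideanSpace.single i (1 : ℝ))‖ ^ (-β)) *
            fun τ : ℝ => (x + t • z) i + τ * t := by
        ext τ
        simp only [Pi.mul_apply]
        congr 1
        · rw [smul_add, smul_comm t τ, add_assoc]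
        · simp; ring
      rw [e]
      refine h3.congr_deriv ?_
      simp only [zero_smul, add_zero, zero_mul, inner_smul_right,
        EuclideanSpace.inner_single_right]
      simp
      ring
  have hint1 : ∀ i : Fin N, Integrable fun z : Space N =>
      w (‖z‖ ^ 2) * (((x + t • z) i * z i) * ‖x + t • z‖ ^ (-β)) := fun i => by
    refine integrable_of_continuousOn_closedBall (R := R) ?_ fun z hz => ?_
    · have := hc (-β)
      have := hcoord i
      fun_prop
    · simp [h0 _ (hsq z hz)]
  have hint2 : ∀ i : Fin N, Integrable fun z : Space N =>
      radialPotential w R z * (t * (‖x + t • z‖ ^ (-β) -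
        β * ((x + t • z) i ^ 2 * ‖x + t • z‖ ^ (-(β + 2))))) := fun i => by
    refine integrable_of_continuousOn_closedBall (R := R) ?_ fun z hz => ?_
    · have := hc (-β)
      have := hc (-(β + 2))
      have := hcoord i
      fun_prop
    · simp [radialPotential_eq_zero hR h0 hz]
  calc ∫ z, w (‖z‖ ^ 2) * (inner ℝ (x + t • z) z * ‖x + t • z‖ ^ (-β))
      = ∫ z, ∑ i, w (‖z‖ ^ 2) * (((x + t • z) i * z i) * ‖x + t • z‖ ^ (-β)) := by
        congr 1; ext z
        rw [← Finset.mul_sum, ← Finset.sum_mul, PiLp.inner_apply]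
        simp [mul_comm]
    _ = ∫ z, ∑ i, radialPotential w R z * (t * (‖x + t • z‖ ^ (-β) -
        β * ((x + t • z) i ^ 2 * ‖x + t • z‖ ^ (-(β + 2))))) := by
        rw [integral_finsetSum _ fun i _ => hint1 i, integral_finsetSum _ fun i _ => hint2 i]
        exact Finset.sum_congr rfl fun i _ => (key i).symm
    _ = ∫ z, (t * (N - β)) * (radialPotential w R z * ‖x + t • z‖ ^ (-β)) := by
        congr 1; ext z
        by_cases hz : z ∈ Metric.closedBall (0 : Space N) R
        · have hy : 0 < ‖x + t • z‖ := norm_pos_iff.2 (hne z hz)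
          have hs : ∑ i, (x + t • z) i ^ 2 = ‖x + t • z‖ ^ 2 :=
            (EuclideanSpace.real_norm_sq_eq _).symm
          have hp : ‖x + t • z‖ ^ 2 * ‖x + t • z‖ ^ (-(β + 2)) = ‖x + t • z‖ ^ (-β) := by
            rw [← Real.rpow_natCast, ← Real.rpow_add hy]; congr 1; push_cast; ring
          rw [← Finset.mul_sum, ← Finset.mul_sum, Finset.sum_sub_distrib, ← Finset.mul_sum,
            ← Finset.sum_mul, hs, hp]
          simp
          ring
        · rw [mem_closedBall_zero_iff, not_le] at hz
          simp [radialPotential_eq_zero hR h0 hz.le]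
    _ = _ := integral_const_mul _ _

/-- Weighted mean value inequality for the subharmonic function `|y|^{-a}`, `a ≥ N - 2`, on balls
around `x` that do not contain the origin. -/
theorem integral_radial_mul_norm_rpow_sub_nonneg {N : ℕ} {w : ℝ → ℝ} (hw : Continuous w)
    (hw0 : ∀ v, 0 ≤ w v) {R : ℝ} (hR : 0 ≤ R) (h0 : ∀ v, R ^ 2 ≤ v → w v = 0) {a : ℝ}
    (ha0 : 0 ≤ a) (ha : (N : ℝ) ≤ a + 2) {x : Space N} (hx : R < ‖x‖) :
    0 ≤ ∫ z, w (‖z‖ ^ 2) * (‖x + z‖ ^ (-a) - ‖x‖ ^ (-a)) := by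
  set D : Space N → ℝ → ℝ := fun z t =>
    -a * (inner ℝ (x + t • z) z * ‖x + t • z‖ ^ (-(a + 2))) with hD
  set B := Metric.closedBall (0 : Space N) R with hB
  have hcont : ContinuousOn (fun p : Space N × ℝ => D p.1 p.2) (B ×ˢ Icc 0 1) := by
    have hr : ContinuousOn (fun p : Space N × ℝ => ‖x + p.2 • p.1‖ ^ (-(a + 2)))
        (B ×ˢ Icc 0 1) := ContinuousOn.rpow_const (by fun_prop) fun p hp =>
      Or.inl (norm_ne_zero_iff.2 (add_smul_ne_zero_of_norm_lt hx hp.2 hp.1))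
    have hi : Continuous fun p : Space N × ℝ => inner ℝ (x + p.2 • p.1) p.1 := by fun_prop
    exact continuousOn_const.mul (hi.continuousOn.mul hr)
  have hzero : ∀ z, z ∉ B → w (‖z‖ ^ 2) = 0 := fun z hz => by
    rw [hB, mem_closedBall_zero_iff, not_le] at hz
    exact h0 _ (by gcongr)
  have hftc : ∀ z ∈ B, ‖x + z‖ ^ (-a) - ‖x‖ ^ (-a) = ∫ t in Ioc (0 : ℝ) 1, D z t := by
    intro z hz
    rw [← intervalIntegral.integral_of_le zero_le_one,
      intervalIntegral.integral_eq_sub_of_hasDerivAt (f := fun τ : ℝ => ‖x + τ • z‖ ^ (-a))]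
    · simp
    · intro t ht
      rw [uIcc_of_le zero_le_one] at ht
      exact hasDerivAt_norm_rpow_line a x z t (add_smul_ne_zero_of_norm_lt hx ht hz)
    · refine ContinuousOn.intervalIntegrable ?_
      rw [uIcc_of_le zero_le_one]
      exact hcont.comp (f := fun t : ℝ => (z, t)) (by fun_prop) fun t ht => ⟨hz, ht⟩
  have hprod : Integrable (Function.uncurry fun z t => w (‖z‖ ^ 2) * D z t)
      ((volume.restrict B).prod (volume.restrict (Ioc (0 : ℝ) 1))) := by
    rw [Measure.prod_restrict]
    refine IntegrableOn.mono_set (t := B ×ˢ Icc 0 1) ?_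
      (prod_mono_right Ioc_subset_Icc_self)
    refine ContinuousOn.integrableOn_compact ((isCompact_closedBall _ _).prod isCompact_Icc) ?_
    have hwp : Continuous fun p : Space N × ℝ => w (‖p.1‖ ^ 2) := by fun_prop
    exact hwp.continuousOn.mul hcont
  have hrestr : ∀ f : Space N → ℝ, ∫ z in B, w (‖z‖ ^ 2) * f z = ∫ z, w (‖z‖ ^ 2) * f z :=
    fun f => setIntegral_eq_integral_of_forall_compl_eq_zero fun z hz => by simp [hzero z hz]
  rw [← hrestr, setIntegral_congr_fun (g := fun z => ∫ t in Ioc (0 : ℝ) 1, w (‖z‖ ^ 2) * D z t)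
    Metric.isClosed_closedBall.measurableSet
    fun z hz => by simp only [hftc z hz, integral_const_mul], integral_integral_swap hprod]
  refine setIntegral_nonneg measurableSet_Ioc fun t ht => ?_
  have ht' : t ∈ Icc (0 : ℝ) 1 := ⟨ht.1.le, ht.2⟩
  have hib := integral_inner_mul_norm_rpow_eq hw hR h0 hx (a + 2) ht'
  rw [hrestr (fun z => D z t)]
  have : ∀ z, w (‖z‖ ^ 2) * D z t =
      -a * (w (‖z‖ ^ 2) * (inner ℝ (x + t • z) z * ‖x + t • z‖ ^ (-(a + 2)))) := fun z => by
    simp only [hD]; ring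
  simp only [this]
  rw [integral_const_mul, hib]
  have hP : 0 ≤ ∫ z : Space N, radialPotential w R z * ‖x + t • z‖ ^ (-(a + 2)) :=
    integral_nonneg fun z => mul_nonneg (radialPotential_nonneg hR hw0 h0 z)
      (Real.rpow_nonneg (norm_nonneg _) _)
  have h5 : 0 ≤ t * (a + 2 - N) := mul_nonneg ht'.1 (by linarith)
  have h6 := mul_nonneg ha0 (mul_nonneg h5 hP)
  linarith

/-! ### The energy form -/

/-- A symmetric approximation of the kernel `(A - X(|z|²)) |z|^{-(N+2s)}` at `z = x - y`: the first
term is set to zero near the diagonal, in a manner invariant under inversions, and the second one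
is made bounded, in a manner invariant under rotations. -/
noncomputable def approxKernel {N : ℕ} (s A : ℝ) (X : ℝ → ℝ) (ρ δ : ℝ)
    (p : Space N × Space N) : ℝ :=
  A * (shellCompl ρ).indicator (fun p => standardKernel N s (p.1 - p.2)) p -
    X (‖p.1 - p.2‖ ^ 2) * max (‖p.1 - p.2‖ ^ 2) δ ^ (-((N : ℝ) + 2 * s) / 2)

section approxKernel

variable {N : ℕ} {s R A : ℝ} {X : ℝ → ℝ} {ρ δ : ℝ}

theorem approxKernel_swap (s A : ℝ) (X : ℝ → ℝ) (ρ δ : ℝ) (p : Space N × Space N) :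
    approxKernel s A X ρ δ p.swap = approxKernel s A X ρ δ p := by
  have h : p.swap ∈ (shellCompl ρ : Set (Space N × Space N)) ↔ p ∈ shellCompl ρ := or_comm
  have hk : standardKernel N s (p.2 - p.1) = standardKernel N s (p.1 - p.2) := by
    rw [← standardKernel_neg, neg_sub]
  by_cases hp : p ∈ (shellCompl ρ : Set (Space N × Space N))
  · simp [approxKernel, hp, h.2 hp, hk, norm_sub_rev p.2 p.1]
  · simp [approxKernel, hp, mt h.1 hp, norm_sub_rev p.2 p.1]

theorem measurable_approxKernel (hX : Continuous X) :
    Measurable (approxKernel s A X ρ δ : Space N × Space N → ℝ) := by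
  have hk : Measurable fun p : Space N × Space N => standardKernel N s (p.1 - p.2) :=
    (measurable_standardKernel N s).comp (measurable_fst.sub measurable_snd)
  have h1 := hk.indicator (measurableSet_shellCompl ρ)
  have hXm := hX.measurable
  unfold approxKernel
  fun_prop

theorem max_rpow_le_standardKernel (hp : 0 ≤ (N : ℝ) + 2 * s) {z : Space N} (hz : z ≠ 0) :
    max (‖z‖ ^ 2) δ ^ (-((N : ℝ) + 2 * s) / 2) ≤ standardKernel N s z := by
  have h0 : 0 < ‖z‖ := norm_pos_iff.2 hz
  have e : standardKernel N s z = (‖z‖ ^ 2) ^ (-((N : ℝ) + 2 * s) / 2) := by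
    rw [standardKernel, ← Real.rpow_natCast, ← Real.rpow_mul h0.le]
    congr 1; push_cast; ring
  rw [e]
  exact Real.rpow_le_rpow_of_nonpos (by positivity) (le_max_left _ _) (by linarith)

theorem abs_approxKernel_le (hp : 0 ≤ (N : ℝ) + 2 * s) (hX0 : ∀ v, 0 ≤ X v)
    (hXA : ∀ v, X v ≤ A) {x y : Space N} (hxy : x ≠ y) :
    |approxKernel s A X ρ δ (x, y)| ≤ A * standardKernel N s (x - y) := by
  have hA : 0 ≤ A := (hX0 0).trans (hXA 0)
  have hk := standardKernel_nonneg N s (x - y)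
  have h1 := max_rpow_le_standardKernel (δ := δ) hp (sub_ne_zero.2 hxy)
  have h0 : 0 ≤ max (‖x - y‖ ^ 2) δ ^ (-((N : ℝ) + 2 * s) / 2) := by positivity
  have h2 := mul_le_mul (hXA (‖x - y‖ ^ 2)) h1 h0 hA
  have h3 := mul_nonneg (hX0 (‖x - y‖ ^ 2)) h0
  have h4 := mul_nonneg hA hk
  by_cases hp : (x, y) ∈ (shellCompl ρ : Set (Space N × Space N))
  · simp only [approxKernel, indicator_of_mem hp]
    rw [abs_le]; constructor <;> linarith
  · simp only [approxKernel, indicator_of_notMem hp]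
    rw [abs_le]; constructor <;> linarith

theorem approxKernel_nonneg (hp : 0 ≤ (N : ℝ) + 2 * s) (hX0 : ∀ v, 0 ≤ X v)
    (hXA : ∀ v, X v ≤ A) {x y : Space N} (hxy : x ≠ y)
    (h : (x, y) ∈ (shellCompl ρ : Set (Space N × Space N))) :
    0 ≤ approxKernel s A X ρ δ (x, y) := by
  have hA : 0 ≤ A := (hX0 0).trans (hXA 0)
  have h1 := max_rpow_le_standardKernel (δ := δ) hp (sub_ne_zero.2 hxy)
  have h0 : 0 ≤ max (‖x - y‖ ^ 2) δ ^ (-((N : ℝ) + 2 * s) / 2) := by positivity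
  have h2 := mul_le_mul (hXA (‖x - y‖ ^ 2)) h1 h0 hA
  simp only [approxKernel, indicator_of_mem h]
  linarith

/-- Away from the origin the approximating kernel is bounded by an integrable function of
`y - x`: points of `shellCompl ρ` satisfy `|x - y| ≥ (1 - 1/ρ) |x|`. -/
theorem exists_integrable_abs_approxKernel_le (hs0 : 0 < s) (hs1 : s < 1) (hN0 : 0 < N)
    (hR : 0 < R) (hX0 : ∀ v, 0 ≤ X v) (hXA : ∀ v, X v ≤ A) (hX1 : ∀ v, R ^ 2 ≤ v → X v = 0)
    (hρ : 1 < ρ) (hδ : 0 < δ) :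
    ∃ κ : Space N → ℝ, Integrable κ ∧
      ∀ x y : Space N, R ≤ ‖x‖ → |approxKernel s A X ρ δ (x, y)| ≤ κ (y - x) := by
  have hA : 0 ≤ A := (hX0 0).trans (hXA 0)
  have hρ0 : 0 < ρ := one_pos.trans hρ
  set d : ℝ := (1 - 1 / ρ) * R with hd
  have hρ1 : 0 < 1 - 1 / ρ := by rw [sub_pos, div_lt_one hρ0]; exact hρ
  have hd0 : 0 < d := by positivity
  set m : ℝ := min (d ^ 2) 1
  have hm : 0 < m := lt_min (by positivity) one_pos
  set D : ℝ := δ ^ (-((N : ℝ) + 2 * s) / 2)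
  have hD : 0 ≤ D := by positivity
  refine ⟨fun z => A / m * (min (‖z‖ ^ 2) 1 * standardKernel N s z) +
    (Metric.ball 0 R).indicator (fun _ => A * D) z, ?_, fun x y hx => ?_⟩
  · refine ((integrable_min_mul_standardKernel hs0 hs1 hN0).const_mul _).add ?_
    exact (integrable_indicator_iff measurableSet_ball).2
      (integrableOn_const measure_ball_lt_top.ne)
  have hk : standardKernel N s (y - x) = standardKernel N s (x - y) := by
    rw [← standardKernel_neg, neg_sub]
  have hk0 := standardKernel_nonneg N s (x - y)
  simp only [hk, norm_sub_rev y x]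
  have hshell : (x, y) ∈ (shellCompl ρ : Set (Space N × Space N)) → d ≤ ‖x - y‖ := by
    have h1 : d ≤ (1 - 1 / ρ) * ‖x‖ := mul_le_mul_of_nonneg_left hx hρ1.le
    have hx0 : 0 < ‖x‖ := hR.trans_le hx
    rintro (h | h) <;> simp only at h
    · have h2 : ‖y‖ - ‖x‖ ≤ ‖x - y‖ := by rw [norm_sub_rev]; exact norm_sub_norm_le y x
      have h3 : 2 ≤ ρ + 1 / ρ := by
        rw [← sub_nonneg, show ρ + 1 / ρ - 2 = (ρ - 1) ^ 2 / ρ by field_simp; ring]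
        positivity
      nlinarith
    · have h2 := norm_sub_norm_le x y
      have h3 : ‖y‖ ≤ 1 / ρ * ‖x‖ := by
        rw [one_div_mul_eq_div, le_div_iff₀ hρ0]; linarith
      linarith
  have hfirst : |A * (shellCompl ρ).indicator (fun p => standardKernel N s (p.1 - p.2)) (x, y)| ≤
      A / m * (min (‖x - y‖ ^ 2) 1 * standardKernel N s (x - y)) := by
    by_cases hp : (x, y) ∈ (shellCompl ρ : Set (Space N × Space N))
    · rw [indicator_of_mem hp, abs_of_nonneg (mul_nonneg hA hk0)]
      have hdm : m ≤ min (‖x - y‖ ^ 2) 1 := min_le_min_right _ (by gcongr; exact hshell hp)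
      calc A * standardKernel N s (x - y)
          = A / m * (m * standardKernel N s (x - y)) := by field_simp
        _ ≤ _ := by gcongr
    · rw [indicator_of_notMem hp, mul_zero, abs_zero]
      have : 0 ≤ min (‖x - y‖ ^ 2) 1 := le_min (by positivity) zero_le_one
      positivity
  have hsecond : |X (‖x - y‖ ^ 2) * max (‖x - y‖ ^ 2) δ ^ (-((N : ℝ) + 2 * s) / 2)| ≤
      (Metric.ball 0 R).indicator (fun _ => A * D) (y - x) := by
    by_cases hz : y - x ∈ Metric.ball (0 : Space N) R
    · rw [indicator_of_mem hz, abs_of_nonneg (mul_nonneg (hX0 _) (by positivity))]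
      refine mul_le_mul (hXA _) ?_ (by positivity) hA
      have : (0 : ℝ) ≤ N := Nat.cast_nonneg N
      exact Real.rpow_le_rpow_of_nonpos hδ (le_max_right _ _) (by linarith)
    · rw [indicator_of_notMem hz]
      rw [mem_ball_zero_iff, not_lt, norm_sub_rev] at hz
      rw [hX1 _ (by gcongr)]; simp
  exact (abs_sub _ _).trans (add_le_add hfirst hsecond)

/-- For fixed `x` outside the closed ball, the approximate operator applied to `Γ_*` is
nonnegative. Write `Γ_* = Γ - g` with `Γ(y) = |y|^{-(N-2s)}` and `g ≥ 0` supported in the ball. In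
the contribution of `Γ`, the first part of the kernel gives zero by inversion and the second part
gives a nonnegative term by the mean value inequality; on the support of `g` the kernel is
nonnegative. -/
theorem integral_truncatedFundamental_sub_mul_approxKernel_nonneg (hs0 : 0 < s) (hs1 : s < 1)
    (hN : 2 * s < N) (hR : 0 < R) (hX : Continuous X) (hX0 : ∀ v, 0 ≤ X v)
    (hXA : ∀ v, X v ≤ A) (hX1 : ∀ v, R ^ 2 ≤ v → X v = 0) (hρ : 1 < ρ) (hδ : 0 < δ)
    {x : Space N} (hx : R < ‖x‖) (hxρ : ρ * R ≤ ‖x‖) :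
    0 ≤ ∫ y, (truncatedFundamental N s R x - truncatedFundamental N s R y) *
      approxKernel s A X ρ δ (x, y) := by
  have hN0 : 0 < N := dimension_pos hs0 hN
  have hp : 0 ≤ (N : ℝ) + 2 * s := by positivity
  have := nontrivial_space hN0
  have hA : 0 ≤ A := (hX0 0).trans (hXA 0)
  have hx0 : x ≠ 0 := norm_pos_iff.1 (hR.trans hx)
  set α : ℝ := (N : ℝ) - 2 * s with hα
  have hα0 : 0 < α := by linarith
  set u := truncatedFundamental N s R with hu
  set G : Space N → ℝ := fun y => approxKernel s A X ρ δ (x, y) with hG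
  set w : ℝ → ℝ := fun v => X v * max v δ ^ (-((N : ℝ) + 2 * s) / 2) with hw
  have hwc : Continuous w := hX.mul ((continuous_id.max continuous_const).rpow_const
    fun v => Or.inl (lt_max_of_lt_right hδ).ne')
  have hw0 : ∀ v, 0 ≤ w v := fun v => mul_nonneg (hX0 v)
    (Real.rpow_nonneg (hδ.le.trans (le_max_right _ _)) _)
  have hw1 : ∀ v, R ^ 2 ≤ v → w v = 0 := fun v hv => by simp [hw, hX1 v hv]
  have hGm : Measurable G := (measurable_approxKernel hX).comp measurable_prodMk_left
  have hum : Measurable u := (continuous_truncatedFundamental hN hR).measurable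
  set a : Space N → ℝ := fun y => (u x - u y) * G y with ha
  set b : Space N → ℝ := fun y => w (‖y - x‖ ^ 2) * (‖y‖ ^ (-α) - ‖x‖ ^ (-α)) with hb
  set g : Space N → ℝ := fun y => ‖y‖ ^ (-α) - u y with hg
  set c : Space N → ℝ := fun y => g y * G y with hc
  have hout : ∀ y : Space N, R ≤ ‖y‖ → u y = ‖y‖ ^ (-α) := fun y hy => by
    rw [hu, truncatedFundamental_eq_rpow_max hN hR, max_eq_left hy]
  have hg0 : ∀ y, R ≤ ‖y‖ → g y = 0 := fun y hy => by simp [hg, hout y hy]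
  -- integrability of the three parts
  have hai : Integrable a := by
    obtain ⟨κ, hκ, hle⟩ := exists_integrable_abs_approxKernel_le hs0 hs1 hN0 hR hX0 hXA hX1 hρ hδ
    refine ((hκ.comp_sub_right x).const_mul (R ^ (-α))).mono'
      (by fun_prop) (ae_of_all _ fun y => ?_)
    rw [norm_mul, Real.norm_eq_abs, Real.norm_eq_abs]
    exact mul_le_mul (abs_truncatedFundamental_sub_le hN hR x y) (hle x y hx.le) (abs_nonneg _)
      (by positivity)
  have hb' : Integrable fun z => w (‖z‖ ^ 2) * (‖x + z‖ ^ (-α) - ‖x‖ ^ (-α)) := by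
    refine integrable_of_continuousOn_closedBall (R := R) ?_ fun z hz => ?_
    · have h1 : ContinuousOn (fun z : Space N => ‖x + z‖ ^ (-α)) (Metric.closedBall 0 R) :=
        ContinuousOn.rpow_const (by fun_prop) fun z hz => Or.inl (norm_ne_zero_iff.2 (by
          simpa using add_smul_ne_zero_of_norm_lt hx (right_mem_Icc.2 zero_le_one) hz))
      fun_prop
    · rw [hw1 _ (by gcongr), zero_mul]
  have hbz : ∀ y, b y = w (‖y - x‖ ^ 2) * (‖x + (y - x)‖ ^ (-α) - ‖x‖ ^ (-α)) := fun y => by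
    simp [hb]
  have hbi : Integrable b := by
    rw [funext hbz]; exact hb'.comp_sub_right x
  have hb0 : 0 ≤ ∫ y, b y := by
    rw [funext hbz, integral_sub_right_eq_self
      (fun z => w (‖z‖ ^ 2) * (‖x + z‖ ^ (-α) - ‖x‖ ^ (-α))) x]
    exact integral_radial_mul_norm_rpow_sub_nonneg hwc hw0 hR.le hw1 hα0.le (by linarith) hx
  have hgi : Integrable g := by
    rw [← integrableOn_iff_integrable_of_support_subset (s := Metric.ball 0 R)]
    · refine (integrableOn_ball_norm_rpow hs0 hN0 R).sub ?_
      exact ((continuous_truncatedFundamental hN hR).continuousOn.integrableOn_compact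
        (isCompact_closedBall 0 R)).mono_set Metric.ball_subset_closedBall
    · intro y hy
      rw [mem_ball_zero_iff]
      by_contra! h
      exact hy (hg0 y h)
  have hci : Integrable c := by
    refine (hgi.norm.mul_const (A * (‖x‖ - R) ^ (-((N : ℝ) + 2 * s)))).mono'
      (by fun_prop) (ae_of_all _ fun y => ?_)
    rcases le_or_gt R ‖y‖ with h | h
    · simp [hc, hg0 y h]
    · have hxy : x ≠ y := by rintro rfl; linarith
      rw [norm_mul, Real.norm_eq_abs (G y)]
      refine mul_le_mul_of_nonneg_left ((abs_approxKernel_le hp hX0 hXA hxy).trans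
        (mul_le_mul_of_nonneg_left ?_ hA)) (norm_nonneg _)
      have h1 := norm_sub_norm_le x y
      exact Real.rpow_le_rpow_of_nonpos (by linarith) (by linarith) (by linarith)
  have hae : ∀ᵐ y : Space N, y ≠ 0 :=
    compl_mem_ae_iff.2 (measure_singleton (0 : Space N))
  -- the origin is left out: there `‖y‖ ^ (-α)` is `0` instead of `+∞`, so `g` is negative
  have hc0 : 0 ≤ ∫ y, c y := by
    refine integral_nonneg_of_ae ?_
    filter_upwards [hae] with y hy
    rcases le_or_gt R ‖y‖ with h | h
    · simp [hc, hg0 y h]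
    · have hxy : x ≠ y := by rintro rfl; linarith
      refine mul_nonneg ?_ (approxKernel_nonneg hp hX0 hXA hxy (Or.inr ?_))
      · simp only [hg, hu, truncatedFundamental_eq_rpow_max hN hR, sub_nonneg]
        exact Real.rpow_le_rpow_of_nonpos (norm_pos_iff.2 hy) (le_max_left _ _) (by linarith)
      · exact (mul_le_mul_of_nonneg_left h.le (by linarith)).trans hxρ
  -- the contribution of `Γ` and of the first part of the kernel vanishes
  have he : ∫ y, (a y - b y - c y) = 0 := by
    have hTm : MeasurableSet {y : Space N | y ≠ 0 ∧ (x, y) ∈ shellCompl ρ} :=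
      (measurableSet_singleton 0).compl.inter
        (measurableSet_shellCompl ρ |>.preimage (by fun_prop))
    have h1 : (fun y => a y - b y - c y) =ᵐ[volume]
        {y : Space N | y ≠ 0 ∧ (x, y) ∈ shellCompl ρ}.indicator fun y =>
          A * ((‖x‖ ^ (-α) - ‖y‖ ^ (-α)) * standardKernel N s (x - y)) := by
      filter_upwards [hae] with y hy
      simp only [ha, hb, hc, hg, hG, hw, hout x hx.le, approxKernel, norm_sub_rev y x]
      by_cases h : (x, y) ∈ (shellCompl ρ : Set (Space N × Space N))
      · rw [indicator_of_mem h,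
          indicator_of_mem (show y ∈ {y : Space N | y ≠ 0 ∧ (x, y) ∈ shellCompl ρ} from ⟨hy, h⟩)]
        ring
      · rw [indicator_of_notMem h, indicator_of_notMem (fun h' => h h'.2)]
        ring
    rw [integral_congr_ae h1, integral_indicator hTm, integral_const_mul,
      setIntegral_shellCompl_eq_zero hx0, mul_zero]
  have hsum : ∫ y, (a y - b y - c y) = (∫ y, a y) - (∫ y, b y) - ∫ y, c y := by
    rw [← integral_sub hai hbi]
    exact integral_sub (hai.sub hbi) hci
  linarith

end approxKernel

/-- Testing with a symmetric kernel: the two increments of `φ` contribute equally. -/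
theorem integral_energy_eq_two_mul {N : ℕ} {u φ : Space N → ℝ} {G : Space N × Space N → ℝ}
    (hsymm : ∀ p, G p.swap = G p)
    (hint : Integrable (fun p : Space N × Space N => φ p.1 * ((u p.1 - u p.2) * G p))
      (volume.prod volume)) :
    ∫ p : Space N × Space N, (u p.1 - u p.2) * (φ p.1 - φ p.2) * G p ∂(volume.prod volume) =
      2 * ∫ x, φ x * ∫ y, (u x - u y) * G (x, y) := by
  set H : Space N × Space N → ℝ := fun p => φ p.1 * ((u p.1 - u p.2) * G p) with hH
  have h1 : ∀ p : Space N × Space N, (u p.1 - u p.2) * (φ p.1 - φ p.2) * G p =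
      H p + H p.swap := fun p => by
    simp only [hH, Prod.fst_swap, Prod.snd_swap, hsymm]; ring
  have h2 : ∫ p, H p.swap ∂((volume : Measure (Space N)).prod volume) =
      ∫ p, H p ∂((volume : Measure (Space N)).prod volume) := integral_prod_swap H
  have h3 : ∫ p, (H p + H p.swap) ∂((volume : Measure (Space N)).prod volume) =
      (∫ p, H p ∂(volume.prod volume)) + ∫ p, H p.swap ∂(volume.prod volume) :=
    integral_add hint hint.swap
  simp only [h1]
  rw [h3, h2, integral_prod _ hint, ← two_mul]
  simp only [hH, integral_const_mul]

/-- `Γ_*` is a weak supersolution for every kernel `(A - X(|z|²)) |z|^{-(N+2s)}` with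
`0 ≤ X ≤ A` whose perturbation `X` is continuous and vanishes for `|z| ≥ R`. -/
theorem isWeakSupersolution_truncatedFundamental {N : ℕ} {s R A : ℝ} {X : ℝ → ℝ} (hs0 : 0 < s)
    (hs1 : s < 1) (hN : 2 * s < N) (hR : 0 < R) (hX : Continuous X) (hX0 : ∀ v, 0 ≤ X v)
    (hXA : ∀ v, X v ≤ A) (hX1 : ∀ v, R ^ 2 ≤ v → X v = 0) :
    IsWeakSupersolution (fun z : Space N => (A - X (‖z‖ ^ 2)) * standardKernel N s z)
      (truncatedFundamental N s R) (exteriorDomain N R) := by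
  intro φ hφ
  have hN0 : 0 < N := dimension_pos hs0 hN
  have hp : 0 ≤ (N : ℝ) + 2 * s := by positivity
  have hA : 0 ≤ A := (hX0 0).trans (hXA 0)
  set u := truncatedFundamental N s R with hu
  have huc : Continuous u := continuous_truncatedFundamental hN hR
  have hum := huc.measurable
  have hφm := hφ.smooth.continuous.measurable
  have hkm := measurable_standardKernel N s
  have hXm := hX.measurable
  set K : Space N → ℝ := fun z => (A - X (‖z‖ ^ 2)) * standardKernel N s z with hK
  have hstd := integrable_energyDensity_standardKernel hs0 hs1 hN hR hφ.smooth hφ.compact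
  have hKi : Integrable (energyDensity K u φ) (volume.prod volume) := by
    refine (hstd.norm.const_mul A).mono' ?_ (ae_of_all _ fun p => ?_)
    · unfold energyDensity
      simp only [hK]
      fun_prop
    · have h1 : |A - X (‖p.1 - p.2‖ ^ 2)| ≤ A := by
        have := hX0 (‖p.1 - p.2‖ ^ 2)
        have := hXA (‖p.1 - p.2‖ ^ 2)
        rw [abs_le]; constructor <;> linarith
      have h2 : energyDensity K u φ p = (A - X (‖p.1 - p.2‖ ^ 2)) *
          energyDensity (standardKernel N s) u φ p := by
        simp only [energyDensity, hK]; ring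
      rw [h2, norm_mul]
      exact mul_le_mul_of_nonneg_right h1 (norm_nonneg _)
  refine ⟨hKi, ?_⟩
  -- the support of `φ` keeps a positive distance from the ball
  obtain ⟨d, hd0, hd⟩ : ∃ d : ℝ, 0 < d ∧ ∀ x ∈ tsupport φ, (1 + d) * R ≤ ‖x‖ := by
    rcases (tsupport φ).eq_empty_or_nonempty with h | h
    · exact ⟨1, one_pos, by simp [h]⟩
    · obtain ⟨x₀, hx₀, hmin⟩ := hφ.compact.isCompact.exists_isMinOn h continuous_norm.continuousOn
      have h1 : R < ‖x₀‖ := by simpa [exteriorDomain] using hφ.support hx₀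
      refine ⟨‖x₀‖ / R - 1, by rw [sub_pos, one_lt_div hR]; exact h1, fun x hx => ?_⟩
      have h2 : (1 + (‖x₀‖ / R - 1)) * R = ‖x₀‖ := by field_simp; ring
      rw [h2]
      exact hmin hx
  set ρ : ℕ → ℝ := fun n => 1 + d * (1 / ((n : ℝ) + 1)) with hρ
  set δ : ℕ → ℝ := fun n => 1 / ((n : ℝ) + 1) with hδ
  have hδ0 : ∀ n, 0 < δ n := fun n => by positivity
  have hρ1 : ∀ n, 1 < ρ n := fun n => by
    have := mul_pos hd0 (hδ0 n)
    simp only [hρ]; linarith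
  have hρd : ∀ n, ρ n ≤ 1 + d := fun n => by
    have h1 : δ n ≤ 1 := by
      simp only [hδ]
      rw [div_le_one (by positivity)]
      linarith [(Nat.cast_nonneg n : (0 : ℝ) ≤ n)]
    have := mul_le_mul_of_nonneg_left h1 hd0.le
    simp only [hρ]; linarith
  have hδlim : Filter.Tendsto δ Filter.atTop (nhds 0) := tendsto_one_div_add_atTop_nhds_zero_nat
  have hρlim : Filter.Tendsto ρ Filter.atTop (nhds 1) := by
    simpa using (hδlim.const_mul d).const_add 1
  set G : ℕ → Space N × Space N → ℝ := fun n => approxKernel s A X (ρ n) (δ n) with hG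
  have hGm : ∀ n, Measurable (G n) := fun n => measurable_approxKernel hX
  have hlim : Filter.Tendsto (fun n => ∫ p : Space N × Space N,
      (u p.1 - u p.2) * (φ p.1 - φ p.2) * G n p ∂(volume.prod volume)) Filter.atTop
      (nhds (∫ p, energyDensity K u φ p ∂(volume.prod volume))) := by
    refine tendsto_integral_of_dominated_convergence
      (fun p => A * ‖energyDensity (standardKernel N s) u φ p‖) (fun n => ?_)
      (hstd.norm.const_mul A) (fun n => ae_of_all _ fun p => ?_) (ae_of_all _ fun p => ?_)
    · have := hGm n
      fun_prop
    · obtain ⟨x, y⟩ := p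
      rcases eq_or_ne x y with rfl | hxy
      · simp [energyDensity]
      · have h1 : |G n (x, y)| ≤ A * standardKernel N s (x - y) :=
          abs_approxKernel_le hp hX0 hXA hxy
        simp only [energyDensity, norm_mul]
        rw [Real.norm_eq_abs (G n (x, y)), Real.norm_of_nonneg (standardKernel_nonneg N s _)]
        calc _ ≤ ‖u x - u y‖ * ‖φ x - φ y‖ * (A * standardKernel N s (x - y)) :=
              mul_le_mul_of_nonneg_left h1 (by positivity)
          _ = _ := by ring
    · obtain ⟨x, y⟩ := p
      simp only [energyDensity]
      -- on `|x| = |y|`, where the kernels need not converge, the increment of `u` vanishes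
      by_cases hxy : ‖x‖ = ‖y‖
      · have : u x = u y := by
          rw [hu, truncatedFundamental_eq_rpow_max hN hR, truncatedFundamental_eq_rpow_max hN hR,
            hxy]
        simp [this]
      refine Filter.Tendsto.const_mul _ (tendsto_const_nhds.congr' ?_)
      have hne : 0 < ‖x - y‖ := norm_pos_iff.2 (sub_ne_zero.2 fun h => hxy (by rw [h]))
      have hshell : ∀ᶠ n in Filter.atTop,
          (x, y) ∈ (shellCompl (ρ n) : Set (Space N × Space N)) := by
        rcases lt_or_gt_of_ne hxy with h | h
        · have := (hρlim.mul_const ‖x‖).eventually_lt_const (u := ‖y‖) (by simpa using h)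
          filter_upwards [this] with n hn using Or.inl hn.le
        · have := (hρlim.mul_const ‖y‖).eventually_lt_const (u := ‖x‖) (by simpa using h)
          filter_upwards [this] with n hn using Or.inr hn.le
      filter_upwards [hshell, hδlim.eventually_lt_const (u := ‖x - y‖ ^ 2) (by positivity)]
        with n h1 h2
      have h3 : (‖x - y‖ ^ 2) ^ (-((N : ℝ) + 2 * s) / 2) = standardKernel N s (x - y) := by
        rw [standardKernel, ← Real.rpow_natCast, ← Real.rpow_mul hne.le]
        congr 1; push_cast; ring
      simp only [hG, hK, approxKernel, indicator_of_mem h1, max_eq_left h2.le, h3]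
      ring
  have hform : energyForm K u φ = ∫ p, energyDensity K u φ p ∂(volume.prod volume) :=
    (integral_prod _ hKi).symm
  rw [hform]
  refine ge_of_tendsto' hlim fun n => ?_
  obtain ⟨κ, hκ, hle⟩ := exists_integrable_abs_approxKernel_le hs0 hs1 hN0 hR hX0 hXA hX1
    (hρ1 n) (hδ0 n)
  have hsupp : ∀ x, φ x ≠ 0 → R < ‖x‖ ∧ ρ n * R ≤ ‖x‖ := fun x hx => by
    have h1 := hd x (subset_tsupport φ hx)
    have h2 := mul_le_mul_of_nonneg_right (hρd n) hR.le
    have h3 := mul_lt_mul_of_pos_right (hρ1 n) hR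
    constructor <;> linarith
  rw [integral_energy_eq_two_mul (fun p => approxKernel_swap s A X (ρ n) (δ n) p)]
  · refine mul_nonneg zero_le_two (integral_nonneg fun x => ?_)
    by_cases hx : φ x = 0
    · simp [hx]
    · exact mul_nonneg (hφ.nonneg x)
        (integral_truncatedFundamental_sub_mul_approxKernel_nonneg hs0 hs1 hN hR hX hX0 hXA hX1
          (hρ1 n) (hδ0 n) (hsupp x hx).1 (hsupp x hx).2)
  · have hφi : Integrable φ := hφ.smooth.continuous.integrable_of_hasCompactSupport hφ.compact
    refine ((integrable_prod_mul_comp_sub hφi.norm hκ).const_mul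
      (R ^ (-((N : ℝ) - 2 * s)))).mono' ?_ (ae_of_all _ fun p => ?_)
    · have hGn : Measurable (approxKernel s A X (ρ n) (δ n) : Space N × Space N → ℝ) := hGm n
      have hm : Measurable fun p : Space N × Space N =>
          φ p.1 * ((u p.1 - u p.2) * approxKernel s A X (ρ n) (δ n) p) := by fun_prop
      exact hm.aestronglyMeasurable
    · obtain ⟨x, y⟩ := p
      by_cases hx : φ x = 0
      · simp [hx]
      · have h1 := hle x y (hsupp x hx).1.le
        have h2 := abs_truncatedFundamental_sub_le hN hR x y
        rw [norm_mul, norm_mul, Real.norm_eq_abs (u x - u y), Real.norm_eq_abs (G n (x, y))]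
        calc _ ≤ ‖φ x‖ * (R ^ (-((N : ℝ) - 2 * s)) * κ (y - x)) :=
              mul_le_mul_of_nonneg_left (mul_le_mul h2 h1 (abs_nonneg _) (by positivity))
                (norm_nonneg _)
          _ = _ := by ring

theorem fracLapConst_pos {N : ℕ} {s : ℝ} (hs0 : 0 < s) (hs1 : s < 1) : 0 < fracLapConst N s := by
  have h1 : 0 < Real.Gamma ((N : ℝ) / 2 + s) := Real.Gamma_pos_of_pos (by positivity)
  have h2 : 0 < Real.Gamma (1 - s) := Real.Gamma_pos_of_pos (by linarith)
  unfold fracLapConst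
  positivity

/-- `1 - a` is a continuous function of `|z|²`, read off along a fixed unit vector. -/
theorem IsRadialCutoff.exists_one_sub_eq {N : ℕ} (hN0 : 0 < N) {R : ℝ}
    {a : Space N → ℝ} (ha : IsRadialCutoff R a) :
    ∃ X : ℝ → ℝ, Continuous X ∧ (∀ v, 0 ≤ X v) ∧ (∀ v, X v ≤ 1) ∧
      (∀ v, R ^ 2 ≤ v → X v = 0) ∧ ∀ z, 1 - a z = X (‖z‖ ^ 2) := by
  set e : Space N := EuclideanSpace.single ⟨0, hN0⟩ (1 : ℝ)
  have he : ‖e‖ = 1 := by simp [e]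
  have hn : ∀ v : ℝ, ‖√v • e‖ = √v := fun v => by
    rw [norm_smul, he, mul_one, Real.norm_of_nonneg (Real.sqrt_nonneg v)]
  have hac := ha.smooth.continuous
  refine ⟨fun v => 1 - a (√v • e), by fun_prop, fun v => by linarith [ha.le_one (√v • e)],
    fun v => by linarith [ha.nonneg (√v • e)], fun v hv => ?_, fun z => ?_⟩
  · simp only
    rw [ha.eq_one _ (by rw [hn]; exact Real.le_sqrt_of_sq_le hv), sub_self]
  · rw [ha.radial z (√(‖z‖ ^ 2) • e) (by rw [hn, Real.sqrt_sq (norm_nonneg z)])]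

theorem kernelHypotheses_perturbedKernel {N : ℕ} {s R : ℝ} (hs0 : 0 < s) (hs1 : s < 1)
    (hN : 2 * s < N) (hR : 0 < R) {a : Space N → ℝ} (ha : IsRadialCutoff R a) :
    KernelHypotheses N s R (perturbedKernel N s a) := by
  have hN0 : 0 < N := dimension_pos hs0 hN
  have ham := ha.smooth.continuous.measurable
  have hkm := measurable_standardKernel N s
  have hm : Measurable (perturbedKernel N s a) := by
    unfold perturbedKernel; fun_prop
  have hle : ∀ x, perturbedKernel N s a x ≤ 2 * standardKernel N s x := fun x =>
    mul_le_mul_of_nonneg_right (by linarith [ha.le_one x]) (standardKernel_nonneg N s x)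
  have hge : ∀ x, standardKernel N s x ≤ perturbedKernel N s a x := fun x =>
    le_mul_of_one_le_left (standardKernel_nonneg N s x) (by linarith [ha.nonneg x])
  refine ⟨hm, fun x hx => ?_, fun x => ?_, ⟨1, one_pos, ae_of_all _ fun x => ?_⟩, ?_,
    ⟨2, two_pos, ae_of_all _ hle⟩, ?_⟩
  · exact (Real.rpow_pos_of_pos (norm_pos_iff.2 hx) _).trans_le (hge x)
  · simp only [perturbedKernel, standardKernel_neg, ha.radial (-x) x (norm_neg x)]
  · rw [one_mul]; exact hge x
  · refine ((integrable_min_mul_standardKernel hs0 hs1 hN0).const_mul 2).mono' (by fun_prop)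
      (ae_of_all _ fun x => ?_)
    have h1 : 0 ≤ min (‖x‖ ^ 2) 1 := le_min (by positivity) zero_le_one
    rw [Real.norm_of_nonneg (mul_nonneg h1 ((standardKernel_nonneg N s x).trans (hge x)))]
    calc _ ≤ min (‖x‖ ^ 2) 1 * (2 * standardKernel N s x) := mul_le_mul_of_nonneg_left (hle x) h1
      _ = _ := by ring
  · obtain ⟨X, hX, hX0, hX1, hXR, hXa⟩ := ha.exists_one_sub_eq hN0
    have := isWeakSupersolution_truncatedFundamental (A := 2) hs0 hs1 hN hR hX hX0
      (fun v => (hX1 v).trans one_le_two) hXR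
    convert this using 1
    ext z
    rw [← hXa z, perturbedKernel]
    ring

theorem isWeakSupersolution_fracLapKernel {N : ℕ} {s R : ℝ} (hs0 : 0 < s) (hs1 : s < 1)
    (hN : 2 * s < N) (hR : 0 < R) :
    IsWeakSupersolution (fracLapKernel N s) (truncatedFundamental N s R) (exteriorDomain N R) := by
  have := isWeakSupersolution_truncatedFundamental (A := fracLapConst N s) (X := fun _ => 0)
    hs0 hs1 hN hR continuous_const (fun _ => le_rfl) (fun _ => (fracLapConst_pos hs0 hs1).le)
    fun _ _ => rfl
  simp only [sub_zero] at this
  exact this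

end NonlocalKernel

theorem mainTheorem4 (N : ℕ) (s R : ℝ) (hs0 : 0 < s) (hs1 : s < 1) (hN : 2 * s < (N : ℝ))
    (hR : 0 < R) :
    NonlocalKernel.IsWeakSupersolution (NonlocalKernel.fracLapKernel N s)
        (NonlocalKernel.truncatedFundamental N s R) (NonlocalKernel.exteriorDomain N R) ∧
      ∀ a : NonlocalKernel.Space N → ℝ, NonlocalKernel.IsRadialCutoff R a →
        NonlocalKernel.KernelHypotheses N s R (NonlocalKernel.perturbedKernel N s a) :=
  ⟨NonlocalKernel.isWeakSupersolution_fracLapKernel hs0 hs1 hN hR,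
    fun _ ha => NonlocalKernel.kernelHypotheses_perturbedKernel hs0 hs1 hN hR ha⟩
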